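/- Let $R$ be a commutative ring. An $R$-algebra $S$ is called an Azumaya $R$-algebra if it is a finitely generated projective faithful $R$-module and the map $S\otimes_R S^{\mathrm{op}}\to\operatorname{End}_R(S)$, $a\otimes b\mapsto(x\mapsto axb)$, is an isomorphism (equivalently, $S$ is a central separable $R$-algebra). The Brauer group $\mathrm{Br}(R)$ is the set of classes $[S]$ of Azumaya $R$-algebras $S$, where $[A]=[B]$ if and only if there are finitely generated projective faithful $R$-modules $P$, $Q$ with $A\otimes_R\operatorname{End}_R(P)\cong B\otimes_R\operatorname{End}_R(Q)$ as $R$-algebras; its group law is $[A]\cdot[B]=[A\otimes_R B]$, with neutral element $[R]$ and inverse $[A]^{-1}=[A^{\mathrm{op}}]$. Let $G$ be a finite group acting on an $R$-algebra $S$ by ring automorphisms that are trivial on the image of $R$. The structure map $R\to S$ is called a $G$-Galois extension if $S$ is a faithfully flat $R$-module and the map $$\Gamma: S\otimes_R S\to S(G)=\operatorname{Map}(G,S),\qquad \Gamma(s\otimes t)=\bigl(g\mapsto s\,g(t)\bigr),$$ is bijective. It is called a $G$-Galois-Azumaya extension if, moreover, $S$ is an Azumaya $R$-algebra. **Corollary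 3.3.** Let $\mathrm{Br}_{\mathrm{Gal}}(R)$ be the set of those classes $\xi\in\mathrm{Br}(R)$ for which there exist a finite group $G$ and a $G$-Galois-Azumaya extension $R\to S$ with $\xi=[S]$. Then $\mathrm{Br}_{\mathrm{Gal}}(R)$ is a subgroup of $\mathrm{Br}(R)$. -/

import Mathlib

open scoped TensorProduct

universe u

namespace BrauerGalois

/-! ### Faithfully projective modules -/

section Modules

/-- A faithfully projective module over a commutative ring (a progenerator): a finitely generated
projective faithful module. -/
class IsFaithfullyProjective (R P : Type*) [CommRing R] [AddCommGroup P] [Module R P] : Prop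
    extends Module.Finite R P, Module.Projective R P, FaithfulSMul R P

variable (R : Type*) [CommRing R] (M N : Type*) [AddCommGroup M] [Module R M]
  [AddCommGroup N] [Module R N]

instance IsFaithfullyProjective.self : IsFaithfullyProjective R R where

/-- The algebra isomorphism `End M ⊗ End N ≃ End (M ⊗ N)`, `f ⊗ g ↦ (m ⊗ n ↦ f m ⊗ g n)`. -/
noncomputable def endTensorEndEquiv [Module.Finite R M] [Module.Projective R M]
    [Module.Finite R N] [Module.Projective R N] :
    Module.End R M ⊗[R] Module.End R N ≃ₐ[R] Module.End R (M ⊗[R] N) :=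
  AlgEquiv.ofBijective
    (Module.endTensorEndAlgHom (R := R) (S := R) (A := R) (M := M) (N := N)) (by
      have h := (homTensorHomEquiv R M N M N).bijective
      convert h using 1
      ext x : 1
      rw [homTensorHomEquiv_apply]
      rfl)

theorem faithfulSMul_tensor [FaithfulSMul R M] [Module.Flat R M] [Module.Finite R N]
    [FaithfulSMul R N] : FaithfulSMul R (M ⊗[R] N) := by
  classical
  obtain ⟨s, hs⟩ := Module.Finite.fg_top (R := R) (M := N)
  -- the map `R → N ^ s` given by the generators of `N` is injective
  let f : R →ₗ[R] (s → N) := LinearMap.pi fun i => LinearMap.toSpanSingleton R N i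
  have hf : Function.Injective f := by
    intro a b hab
    apply FaithfulSMul.eq_of_smul_eq_smul (M := R) (α := N)
    intro n
    have hn : n ∈ Submodule.span R (s : Set N) := by rw [hs]; trivial
    induction hn using Submodule.span_induction with
    | mem x hx => simpa [f] using congrFun hab ⟨x, hx⟩
    | zero => simp
    | add x y _ _ hx hy => rw [smul_add, smul_add, hx, hy]
    | smul r x _ hx => rw [smul_comm, hx, smul_comm]
  have hg := Module.Flat.lTensor_preserves_injective_linearMap (M := M) f hf
  refine ⟨fun {a b} hab => FaithfulSMul.eq_of_smul_eq_smul (M := R) (α := M) fun m => ?_⟩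
  have key : ∀ c : R, TensorProduct.piRight R R M (fun _ : s => N)
      (f.lTensor M (m ⊗ₜ c)) = fun i : s => c • (m ⊗ₜ[R] (i : N)) := by
    intro c
    ext i
    simp [f]
  have h2 : m ⊗ₜ[R] a = m ⊗ₜ[R] b := by
    apply hg
    apply (TensorProduct.piRight R R M (fun _ : s => N)).injective
    rw [key, key]
    funext i
    exact hab _
  simpa using congrArg (TensorProduct.rid R M) h2

instance IsFaithfullyProjective.tensor [IsFaithfullyProjective R M]
    [IsFaithfullyProjective R N] : IsFaithfullyProjective R (M ⊗[R] N) :=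
  { faithfulSMul_tensor R M N with }

end Modules

/-! ### Azumaya algebras: tensor products and opposites -/

section Azumaya

variable (R : Type*) [CommRing R] (A B : Type*) [Ring A] [Algebra R A] [Ring B] [Algebra R B]

/-- An Azumaya algebra is faithfully projective as a module. -/
theorem isFaithfullyProjective_of_isAzumaya [IsAzumaya R A] : IsFaithfullyProjective R A where

theorem isAzumaya_tensor [IsAzumaya R A] [IsAzumaya R B] : IsAzumaya R (A ⊗[R] B) :=
  { faithfulSMul_tensor R A B with
    bij := by
      let e : (A ⊗[R] B) ⊗[R] (A ⊗[R] B)ᵐᵒᵖ ≃ₐ[R] (A ⊗[R] Aᵐᵒᵖ) ⊗[R] (B ⊗[R] Bᵐᵒᵖ) :=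
        (Algebra.TensorProduct.congr AlgEquiv.refl
          (Algebra.TensorProduct.opAlgEquiv R R A B).symm).trans
          (Algebra.TensorProduct.tensorTensorTensorComm R R R R A B Aᵐᵒᵖ Bᵐᵒᵖ)
      let e₂ : (A ⊗[R] Aᵐᵒᵖ) ⊗[R] (B ⊗[R] Bᵐᵒᵖ) ≃ₐ[R] Module.End R (A ⊗[R] B) :=
        (Algebra.TensorProduct.congr
          (AlgEquiv.ofBijective (AlgHom.mulLeftRight R A) IsAzumaya.bij)
          (AlgEquiv.ofBijective (AlgHom.mulLeftRight R B) IsAzumaya.bij)).trans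
          (endTensorEndEquiv R A B)
      have h : AlgHom.mulLeftRight R (A ⊗[R] B) = (e.trans e₂).toAlgHom := by
        have key : ∀ (a : A) (b : B) (a' : A) (b' : B),
            AlgHom.mulLeftRight R (A ⊗[R] B)
              ((a ⊗ₜ[R] b) ⊗ₜ[R] MulOpposite.op (a' ⊗ₜ[R] b')) =
            (e.trans e₂) ((a ⊗ₜ[R] b) ⊗ₜ[R] MulOpposite.op (a' ⊗ₜ[R] b')) := by
          intro a b a' b'
          have he : e ((a ⊗ₜ[R] b) ⊗ₜ[R] MulOpposite.op (a' ⊗ₜ[R] b')) =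
            (a ⊗ₜ[R] MulOpposite.op a') ⊗ₜ[R] (b ⊗ₜ[R] MulOpposite.op b') := rfl
          have he₂ : e₂ ((a ⊗ₜ[R] MulOpposite.op a') ⊗ₜ[R] (b ⊗ₜ[R] MulOpposite.op b')) =
            TensorProduct.map (AlgHom.mulLeftRight R A (a ⊗ₜ MulOpposite.op a'))
              (AlgHom.mulLeftRight R B (b ⊗ₜ MulOpposite.op b')) := rfl
          rw [AlgEquiv.trans_apply, he, he₂]
          ext x y
          simp
        refine AlgHom.ext fun x => ?_
        change _ = (e.trans e₂) x
        induction x using TensorProduct.induction_on with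
        | zero => rw [map_zero, map_zero]
        | add x y hx hy => rw [map_add, map_add, hx, hy]
        | tmul x y =>
          induction x using TensorProduct.induction_on with
          | zero => rw [TensorProduct.zero_tmul, map_zero, map_zero]
          | add x₁ x₂ h₁ h₂ => rw [TensorProduct.add_tmul, map_add, map_add, h₁, h₂]
          | tmul a b =>
            obtain ⟨y, rfl⟩ := MulOpposite.op_surjective y
            induction y using TensorProduct.induction_on with
            | zero => rw [MulOpposite.op_zero, TensorProduct.tmul_zero, map_zero, map_zero]
            | add x₁ x₂ h₁ h₂ =>
              rw [MulOpposite.op_add, TensorProduct.tmul_add, map_add, map_add, h₁, h₂]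
            | tmul a' b' => exact key a b a' b'
      rw [h]
      exact (e.trans e₂).bijective }

theorem isAzumaya_op [IsAzumaya R A] : IsAzumaya R Aᵐᵒᵖ :=
  have h1 : Module.Projective R Aᵐᵒᵖ := .of_equiv (MulOpposite.opLinearEquiv R)
  have h2 : Module.Finite R Aᵐᵒᵖ := .equiv (MulOpposite.opLinearEquiv R)
  have h3 : FaithfulSMul R Aᵐᵒᵖ := ⟨fun {a b} h =>
    FaithfulSMul.eq_of_smul_eq_smul (M := R) (α := A) fun x =>
      MulOpposite.op_injective (h (MulOpposite.op x))⟩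
  { h1, h2, h3 with
    bij := by
      let e : Aᵐᵒᵖ ⊗[R] Aᵐᵒᵖᵐᵒᵖ ≃ₐ[R] A ⊗[R] Aᵐᵒᵖ :=
        (Algebra.TensorProduct.comm R Aᵐᵒᵖ Aᵐᵒᵖᵐᵒᵖ).trans
          (Algebra.TensorProduct.congr (AlgEquiv.opOp R A).symm AlgEquiv.refl)
      let e₂ : A ⊗[R] Aᵐᵒᵖ ≃ₐ[R] Module.End R Aᵐᵒᵖ :=
        (AlgEquiv.ofBijective (AlgHom.mulLeftRight R A) IsAzumaya.bij).trans
          ((MulOpposite.opLinearEquiv R : A ≃ₗ[R] Aᵐᵒᵖ).conjAlgEquiv R)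
      have h : AlgHom.mulLeftRight R Aᵐᵒᵖ = (e.trans e₂).toAlgHom := by
        ext x <;> simp [e, e₂]
      rw [h]
      exact (e.trans e₂).bijective }

end Azumaya
/-! ### The Brauer group of a commutative ring -/

section Brauer

/-- An Azumaya algebra over `R`, bundled. An Azumaya algebra is a finitely generated module, so
that the algebras in the universe of `R` represent all of them up to isomorphism. -/
structure AzumayaAlgebra (R : Type u) [CommRing R] : Type (u + 1) where
  carrier : Type u
  [ring : Ring carrier]
  [algebra : Algebra R carrier]
  [isAzumaya : IsAzumaya R carrier]

attribute [instance] AzumayaAlgebra.ring AzumayaAlgebra.algebra AzumayaAlgebra.isAzumaya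

/-- Brauer equivalence (stable isomorphism): `A ⊗ End P ≃ B ⊗ End Q` as `R`-algebras for some
faithfully projective `R`-modules `P` and `Q`. -/
def BrauerEquivalent (R : Type u) [CommRing R] (A B : Type u) [Ring A] [Algebra R A]
    [Ring B] [Algebra R B] : Prop :=
  ∃ (P Q : Type u) (_ : AddCommGroup P) (_ : Module R P) (_ : AddCommGroup Q) (_ : Module R Q),
    IsFaithfullyProjective R P ∧ IsFaithfullyProjective R Q ∧
      Nonempty (A ⊗[R] Module.End R P ≃ₐ[R] B ⊗[R] Module.End R Q)

namespace BrauerEquivalent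

variable {R : Type u} [CommRing R] {A B C D : Type u} [Ring A] [Algebra R A] [Ring B]
  [Algebra R B] [Ring C] [Algebra R C] [Ring D] [Algebra R D]

theorem of_algEquiv (e : A ≃ₐ[R] B) : BrauerEquivalent R A B :=
  ⟨R, R, inferInstance, inferInstance, inferInstance, inferInstance, inferInstance,
    inferInstance, ⟨Algebra.TensorProduct.congr e AlgEquiv.refl⟩⟩

theorem symm (h : BrauerEquivalent R A B) : BrauerEquivalent R B A := by
  obtain ⟨P, Q, _, _, _, _, hP, hQ, ⟨e⟩⟩ := h
  exact ⟨Q, P, _, _, _, _, hQ, hP, ⟨e.symm⟩⟩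

theorem trans (h : BrauerEquivalent R A B) (h' : BrauerEquivalent R B C) :
    BrauerEquivalent R A C := by
  obtain ⟨P, Q, _, _, _, _, hP, hQ, ⟨e⟩⟩ := h
  obtain ⟨P', Q', _, _, _, _, hP', hQ', ⟨e'⟩⟩ := h'
  refine ⟨P ⊗[R] P', Q' ⊗[R] Q, _, _, _, _, inferInstance, inferInstance, ⟨?_⟩⟩
  exact (Algebra.TensorProduct.congr AlgEquiv.refl (endTensorEndEquiv R P P').symm).trans <|
    (Algebra.TensorProduct.assoc R R R A (Module.End R P) (Module.End R P')).symm.trans <|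
    (Algebra.TensorProduct.congr e AlgEquiv.refl).trans <|
    (Algebra.TensorProduct.assoc R R R B (Module.End R Q) (Module.End R P')).trans <|
    (Algebra.TensorProduct.congr AlgEquiv.refl
      (Algebra.TensorProduct.comm R (Module.End R Q) (Module.End R P'))).trans <|
    (Algebra.TensorProduct.assoc R R R B (Module.End R P') (Module.End R Q)).symm.trans <|
    (Algebra.TensorProduct.congr e' AlgEquiv.refl).trans <|
    (Algebra.TensorProduct.assoc R R R C (Module.End R Q') (Module.End R Q)).trans <|
    Algebra.TensorProduct.congr AlgEquiv.refl (endTensorEndEquiv R Q' Q)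

theorem tensor (h : BrauerEquivalent R A B) (h' : BrauerEquivalent R C D) :
    BrauerEquivalent R (A ⊗[R] C) (B ⊗[R] D) := by
  obtain ⟨P, Q, _, _, _, _, hP, hQ, ⟨e⟩⟩ := h
  obtain ⟨P', Q', _, _, _, _, hP', hQ', ⟨e'⟩⟩ := h'
  refine ⟨P ⊗[R] P', Q ⊗[R] Q', _, _, _, _, inferInstance, inferInstance, ⟨?_⟩⟩
  exact (Algebra.TensorProduct.congr AlgEquiv.refl (endTensorEndEquiv R P P').symm).trans <|
    (Algebra.TensorProduct.tensorTensorTensorComm R R R R A C _ _).trans <|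
    (Algebra.TensorProduct.congr e e').trans <|
    (Algebra.TensorProduct.tensorTensorTensorComm R R R R B _ D _).trans <|
    Algebra.TensorProduct.congr AlgEquiv.refl (endTensorEndEquiv R Q Q')

/-- The endomorphism algebra of a faithfully projective module is equivalent to `R`. -/
theorem end_self (P : Type u) [AddCommGroup P] [Module R P] [IsFaithfullyProjective R P] :
    BrauerEquivalent R (Module.End R P) R :=
  ⟨R, P, inferInstance, inferInstance, inferInstance, inferInstance, inferInstance, inferInstance,
    ⟨(Algebra.TensorProduct.congr AlgEquiv.refl
      ((AlgEquiv.moduleEndSelf R).symm.trans (AlgEquiv.toOpposite R R).symm)).trans <|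
      (Algebra.TensorProduct.rid R R (Module.End R P)).trans
        (Algebra.TensorProduct.lid R (Module.End R P)).symm⟩⟩

theorem op (h : BrauerEquivalent R A B) [IsAzumaya R A] [IsAzumaya R B] :
    BrauerEquivalent R Aᵐᵒᵖ Bᵐᵒᵖ := by
  have hA : BrauerEquivalent R (A ⊗[R] Aᵐᵒᵖ) R :=
    haveI := isFaithfullyProjective_of_isAzumaya R A
    (of_algEquiv (AlgEquiv.ofBijective (AlgHom.mulLeftRight R A) IsAzumaya.bij)).trans (end_self A)
  have hB : BrauerEquivalent R (B ⊗[R] Bᵐᵒᵖ) R :=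
    haveI := isFaithfullyProjective_of_isAzumaya R B
    (of_algEquiv (AlgEquiv.ofBijective (AlgHom.mulLeftRight R B) IsAzumaya.bij)).trans (end_self B)
  have refl : ∀ (X : Type u) [Ring X] [Algebra R X], BrauerEquivalent R X X :=
    fun X _ _ => of_algEquiv AlgEquiv.refl
  -- `Aᵒ ~ Aᵒ ⊗ (B ⊗ Bᵒ) ≃ (B ⊗ Aᵒ) ⊗ Bᵒ ~ (A ⊗ Aᵒ) ⊗ Bᵒ ~ Bᵒ`
  have h1 : BrauerEquivalent R Aᵐᵒᵖ (Aᵐᵒᵖ ⊗[R] (B ⊗[R] Bᵐᵒᵖ)) :=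
    (of_algEquiv (Algebra.TensorProduct.rid R R Aᵐᵒᵖ).symm).trans ((refl _).tensor hB.symm)
  have h2 : BrauerEquivalent R (Aᵐᵒᵖ ⊗[R] (B ⊗[R] Bᵐᵒᵖ)) ((B ⊗[R] Aᵐᵒᵖ) ⊗[R] Bᵐᵒᵖ) :=
    of_algEquiv <| (Algebra.TensorProduct.assoc R R R Aᵐᵒᵖ B Bᵐᵒᵖ).symm.trans
      (Algebra.TensorProduct.congr (Algebra.TensorProduct.comm R Aᵐᵒᵖ B) AlgEquiv.refl)
  have h3 : BrauerEquivalent R ((B ⊗[R] Aᵐᵒᵖ) ⊗[R] Bᵐᵒᵖ) ((A ⊗[R] Aᵐᵒᵖ) ⊗[R] Bᵐᵒᵖ) :=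
    (h.symm.tensor (refl _)).tensor (refl _)
  have h4 : BrauerEquivalent R ((A ⊗[R] Aᵐᵒᵖ) ⊗[R] Bᵐᵒᵖ) Bᵐᵒᵖ :=
    (hA.tensor (refl _)).trans (of_algEquiv (Algebra.TensorProduct.lid R Bᵐᵒᵖ))
  exact h1.trans (h2.trans (h3.trans h4))

end BrauerEquivalent

variable (R : Type u) [CommRing R]

/-- Brauer equivalence of Azumaya algebras, as a setoid. -/
def brauerSetoid : Setoid (AzumayaAlgebra R) where
  r A B := BrauerEquivalent R A.carrier B.carrier
  iseqv :=
    { refl := fun _ => .of_algEquiv AlgEquiv.refl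
      symm := fun h => h.symm
      trans := fun h h' => h.trans h' }

/-- The Brauer group `Br(R)` of a commutative ring `R`: Azumaya `R`-algebras modulo Brauer
equivalence. -/
def Br : Type (u + 1) := Quotient (brauerSetoid R)

namespace Br

variable {R}

/-- The class `[A]` of an Azumaya algebra `A` in the Brauer group. -/
def mk (A : Type u) [Ring A] [Algebra R A] (hA : IsAzumaya R A) : Br R :=
  Quotient.mk (brauerSetoid R) { carrier := A, isAzumaya := hA }

theorem mk_eq_mk_iff {A B : Type u} [Ring A] [Algebra R A] [Ring B] [Algebra R B]
    {hA : IsAzumaya R A} {hB : IsAzumaya R B} :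
    mk A hA = mk B hB ↔ BrauerEquivalent R A B :=
  ⟨fun h => Quotient.exact h, fun h => Quotient.sound (s := brauerSetoid R) h⟩

theorem ind {motive : Br R → Prop}
    (h : ∀ (A : Type u) [Ring A] [Algebra R A] (hA : IsAzumaya R A), motive (mk A hA))
    (x : Br R) : motive x :=
  Quotient.inductionOn x fun A => h A.carrier A.isAzumaya

/-- `[A] * [B] = [A ⊗ B]`. -/
noncomputable instance : Mul (Br R) where
  mul := Quotient.map₂
    (fun A B => { carrier := A.carrier ⊗[R] B.carrier
                  isAzumaya := isAzumaya_tensor R A.carrier B.carrier })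
    (fun _ _ h _ _ h' => BrauerEquivalent.tensor h h')

/-- The neutral element is `[R]`. -/
instance : One (Br R) where
  one := mk R inferInstance

/-- `[A]⁻¹ = [Aᵒ]`, with `Aᵒ` the opposite algebra. -/
noncomputable instance : Inv (Br R) where
  inv := Quotient.map
    (fun A => { carrier := A.carrierᵐᵒᵖ, isAzumaya := isAzumaya_op R A.carrier })
    (fun _ _ h => BrauerEquivalent.op h)

theorem mk_mul_mk {A B : Type u} [Ring A] [Algebra R A] [Ring B] [Algebra R B]
    (hA : IsAzumaya R A) (hB : IsAzumaya R B) :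
    mk A hA * mk B hB = mk (A ⊗[R] B) (isAzumaya_tensor R A B) := rfl

theorem one_def : (1 : Br R) = mk R inferInstance := rfl

theorem inv_mk {A : Type u} [Ring A] [Algebra R A] (hA : IsAzumaya R A) :
    (mk A hA)⁻¹ = mk Aᵐᵒᵖ (isAzumaya_op R A) := rfl

noncomputable instance : CommGroup (Br R) where
  mul_assoc x y z := by
    induction x using ind with | h A hA => ?_
    induction y using ind with | h B hB => ?_
    induction z using ind with | h C hC => ?_
    exact mk_eq_mk_iff.2 (.of_algEquiv (Algebra.TensorProduct.assoc R R R A B C))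
  one_mul x := by
    induction x using ind with | h A hA => ?_
    exact mk_eq_mk_iff.2 (.of_algEquiv (Algebra.TensorProduct.lid R A))
  mul_one x := by
    induction x using ind with | h A hA => ?_
    exact mk_eq_mk_iff.2 (.of_algEquiv (Algebra.TensorProduct.rid R R A))
  mul_comm x y := by
    induction x using ind with | h A hA => ?_
    induction y using ind with | h B hB => ?_
    exact mk_eq_mk_iff.2 (.of_algEquiv (Algebra.TensorProduct.comm R A B))
  inv_mul_cancel x := by
    induction x using ind with | h A hA => ?_
    have := isFaithfullyProjective_of_isAzumaya R A
    exact mk_eq_mk_iff.2 <| (BrauerEquivalent.of_algEquiv <|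
      (Algebra.TensorProduct.comm R Aᵐᵒᵖ A).trans
        (AlgEquiv.ofBijective (AlgHom.mulLeftRight R A) IsAzumaya.bij)).trans (.end_self A)

end Br

end Brauer

/-! ### Galois-Azumaya extensions and the Brauer-Galois set -/

section Galois

variable {R S G : Type*} [CommRing R] [Ring S] [Algebra R S] [Group G]

/-- The Galois map `Γ : S ⊗ S → S(G)`, `Γ(s ⊗ t) = ∑ g, s * g(t) δ_g`, where `S(G)` is the
module of all maps `G → S`. An action of `G` on `S` by ring automorphisms which is trivial on the
image of `R` is the same as a group homomorphism `ρ` from `G` to the group of `R`-algebra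
automorphisms of `S`. -/
noncomputable def galoisMap (ρ : G →* (S ≃ₐ[R] S)) : S ⊗[R] S →ₗ[R] (G → S) :=
  LinearMap.pi fun g => LinearMap.mul' R S ∘ₗ LinearMap.lTensor S (ρ g).toLinearMap

@[simp]
theorem galoisMap_tmul (ρ : G →* (S ≃ₐ[R] S)) (s t : S) (g : G) :
    galoisMap ρ (s ⊗ₜ[R] t) g = s * ρ g t := rfl

/-- For an algebra `S` over a commutative ring `R` and a finite group `G` acting on `S` by
`R`-algebra automorphisms: the structure map `R → S` is a `G`-Galois extension, that is, `S` is a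
faithfully flat `R`-module and the Galois map `Γ : S ⊗ S → S(G)` is an isomorphism. -/
structure IsGaloisExtension [Finite G] (ρ : G →* (S ≃ₐ[R] S)) : Prop where
  faithfullyFlat : Module.FaithfullyFlat R S
  bijective : Function.Bijective (galoisMap ρ)

/-- `R → S` is a `G`-Galois-Azumaya extension: it is `G`-Galois and `S` is an Azumaya
`R`-algebra. -/
structure IsGaloisAzumayaExtension [Finite G] (ρ : G →* (S ≃ₐ[R] S)) : Prop
    extends IsGaloisExtension ρ where
  isAzumaya : IsAzumaya R S

/-- The set `Br_Gal(R)` of the classes in `Br(R)` that are represented by a `G`-Galois-Azumaya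
extension `R → S` for some finite group `G`. -/
def BrGal (R : Type u) [CommRing R] : Set (Br R) :=
  {ξ | ∃ (G : Type) (_ : Group G) (_ : Finite G) (S : Type u) (_ : Ring S) (_ : Algebra R S)
    (ρ : G →* (S ≃ₐ[R] S)) (h : IsGaloisAzumayaExtension ρ), ξ = Br.mk S h.isAzumaya}

end Galois

end BrauerGalois

/-! The three subgroup axioms come from explicit actions on the representing algebras. The unit
`[R]` is Galois for the trivial group. If `S` is Galois for `G` and `T` for `H`, then `G × H` acts
factorwise on `S ⊗ T`, and since `(s ⊗ t) * (g, h)(s' ⊗ t') = s * g(s') ⊗ t * h(t')`, its Galois map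
is the tensor product of the two given ones up to canonical isomorphisms (`galoisMap_tensorAction`).

For inverses, the same `G` acts on `Sᵐᵒᵖ`. Reversing the multiplication turns `s * g(t)` into `g(t)
* s = g(t * g⁻¹(s))`, so the new Galois map is the old one between two bijections
(`galoisMap_opAction`). The Azumaya property is stable under tensor products and opposites, and
these are the operations that define the group law. -/

namespace BrauerGalois

/-! ### Faithful flatness of tensor products -/

section FaithfullyFlat

/-- By associativity, `(M ⊗ N) ⊗ X = 0` means `M ⊗ (N ⊗ X) = 0`, so the factors `M` and `N` can be
cancelled one after the other. -/
theorem faithfullyFlat_tensor (R M N : Type*) [CommRing R] [AddCommGroup M] [Module R M]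
    [AddCommGroup N] [Module R N] [Module.FaithfullyFlat R M] [Module.FaithfullyFlat R N] :
    Module.FaithfullyFlat R (M ⊗[R] N) := by
  rw [Module.FaithfullyFlat.iff_flat_and_lTensor_reflects_triviality]
  refine ⟨inferInstance, fun X _ _ hX => ?_⟩
  have : Subsingleton (M ⊗[R] (N ⊗[R] X)) :=
    (TensorProduct.assoc R M N X).symm.toEquiv.subsingleton
  have : Subsingleton (N ⊗[R] X) :=
    Module.FaithfullyFlat.lTensor_reflects_triviality R M (N ⊗[R] X)
  exact Module.FaithfullyFlat.lTensor_reflects_triviality R N X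

end FaithfullyFlat

/-! ### Induced actions on tensor products and opposite algebras -/

section Actions

variable {R S T G H : Type*} [CommRing R] [Ring S] [Algebra R S] [Ring T] [Algebra R T]
  [Group G] [Group H]

/-- The action of `G × H` on `S ⊗ T` induced by actions of `G` on `S` and of `H` on `T`. -/
noncomputable def tensorAction (ρ : G →* (S ≃ₐ[R] S)) (σ : H →* (T ≃ₐ[R] T)) :
    G × H →* (S ⊗[R] T ≃ₐ[R] S ⊗[R] T) where
  toFun g := Algebra.TensorProduct.congr (ρ g.1) (σ g.2)
  map_one' := by
    -- As algebra homomorphisms out of `S ⊗ T`, both sides are determined by their restrictions to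
    -- the two factors.
    apply AlgEquiv.coe_toAlgHom_injective
    ext <;> simp
  map_mul' g h := by
    apply AlgEquiv.coe_toAlgHom_injective
    ext <;> simp

@[simp]
theorem tensorAction_tmul (ρ : G →* (S ≃ₐ[R] S)) (σ : H →* (T ≃ₐ[R] T)) (g : G × H) (s : S)
    (t : T) : tensorAction ρ σ g (s ⊗ₜ[R] t) = ρ g.1 s ⊗ₜ[R] σ g.2 t := rfl

/-- The action of `G` on the opposite algebra. -/
def opAction (ρ : G →* (S ≃ₐ[R] S)) : G →* (Sᵐᵒᵖ ≃ₐ[R] Sᵐᵒᵖ) where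
  toFun g := AlgEquiv.op (ρ g)
  map_one' := by
    rw [map_one]
    rfl
  map_mul' g h := by
    rw [map_mul]
    rfl

@[simp]
theorem opAction_op (ρ : G →* (S ≃ₐ[R] S)) (g : G) (s : S) :
    opAction ρ g (MulOpposite.op s) = MulOpposite.op (ρ g s) := rfl

end Actions

/-! ### Galois maps of the induced actions -/

section GaloisMap

variable {R S T G H : Type*} [CommRing R] [Ring S] [Algebra R S] [Ring T] [Algebra R T]
  [Group G] [Group H]

/-- The Galois map of the opposite algebra is `Γ` up to swapping the tensor factors, inverting the
group elements and acting: `Γᵒ(s ⊗ t)(g) = g(t) s = g(Γ(t ⊗ s)(g⁻¹))`. -/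
theorem galoisMap_opAction (ρ : G →* (S ≃ₐ[R] S)) (x : S ⊗[R] S) (g : G) :
    galoisMap (opAction ρ)
      (TensorProduct.congr (MulOpposite.opLinearEquiv R) (MulOpposite.opLinearEquiv R)
        (TensorProduct.comm R S S x)) g =
      MulOpposite.op (ρ g (galoisMap ρ x g⁻¹)) := by
  induction x using TensorProduct.induction_on with
  | zero => simp
  | add x y hx hy => simp only [map_add, Pi.add_apply, hx, hy, MulOpposite.op_add]
  | tmul s t =>
    have h : ρ g (ρ g⁻¹ t) = t := by
      rw [← AlgEquiv.mul_apply, ← map_mul, mul_inv_cancel, map_one, AlgEquiv.one_apply]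
    -- `map_inv` would rewrite `ρ g⁻¹` as `(ρ g)⁻¹`, and `h` would no longer match.
    simp [← MulOpposite.op_mul, h, -map_inv]

/-- The tensor product of two finite families of copies of `S` and `T` is the family of copies
of `S ⊗ T` indexed by the product. -/
noncomputable def funTensorFunEquiv (R S T G H : Type*) [CommRing R] [AddCommGroup S] [Module R S]
    [AddCommGroup T] [Module R T] [Fintype G] [DecidableEq G] [Fintype H] [DecidableEq H] :
    (G → S) ⊗[R] (H → T) ≃ₗ[R] (G × H → S ⊗[R] T) :=
  -- Finiteness of `G` and `H` enters here: tensoring commutes with finite products.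
  TensorProduct.piLeft R (H → T) (fun _ : G => S) ≪≫ₗ
    LinearEquiv.piCongrRight (fun _ => TensorProduct.piRight R R S (fun _ : H => T)) ≪≫ₗ
    (LinearEquiv.curry R (S ⊗[R] T) G H).symm

@[simp]
theorem funTensorFunEquiv_tmul (R S T G H : Type*) [CommRing R] [AddCommGroup S] [Module R S]
    [AddCommGroup T] [Module R T] [Fintype G] [DecidableEq G] [Fintype H] [DecidableEq H]
    (f : G → S) (k : H → T) (g : G × H) :
    funTensorFunEquiv R S T G H (f ⊗ₜ[R] k) g = f g.1 ⊗ₜ[R] k g.2 := rfl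

/-- All three maps on the right become bijective once `galoisMap ρ` and `galoisMap σ` are. Linearity
reduces the identity to pure tensors. -/
theorem galoisMap_tensorAction [Fintype G] [DecidableEq G] [Fintype H] [DecidableEq H]
    (ρ : G →* (S ≃ₐ[R] S)) (σ : H →* (T ≃ₐ[R] T)) :
    galoisMap (tensorAction ρ σ) =
      (funTensorFunEquiv R S T G H).toLinearMap ∘ₗ
        TensorProduct.map (galoisMap ρ) (galoisMap σ) ∘ₗ
          (TensorProduct.tensorTensorTensorComm R S T S T).toLinearMap := by
  refine TensorProduct.ext_fourfold' fun s t s' t' => funext fun g => ?_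
  simp

end GaloisMap

/-! ### Galois extensions: tensor product, opposite, trivial group -/

section Galois

variable {R S T G H : Type*} [CommRing R] [Ring S] [Algebra R S] [Ring T] [Algebra R T]
  [Group G] [Finite G] [Group H] [Finite H]

theorem IsGaloisExtension.tensor {ρ : G →* (S ≃ₐ[R] S)} {σ : H →* (T ≃ₐ[R] T)}
    (hρ : IsGaloisExtension ρ) (hσ : IsGaloisExtension σ) :
    IsGaloisExtension (tensorAction ρ σ) where
  faithfullyFlat :=
    haveI := hρ.faithfullyFlat
    haveI := hσ.faithfullyFlat
    faithfullyFlat_tensor R S T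
  bijective := by
    classical
    have := Fintype.ofFinite G
    have := Fintype.ofFinite H
    rw [galoisMap_tensorAction]
    exact (funTensorFunEquiv R S T G H).bijective.comp <|
      (TensorProduct.congr (LinearEquiv.ofBijective _ hρ.bijective)
        (LinearEquiv.ofBijective _ hσ.bijective)).bijective.comp
        (TensorProduct.tensorTensorTensorComm R S T S T).bijective

theorem IsGaloisExtension.op {ρ : G →* (S ≃ₐ[R] S)} (hρ : IsGaloisExtension ρ) :
    IsGaloisExtension (opAction ρ) where
  faithfullyFlat :=
    haveI := hρ.faithfullyFlat
    .of_linearEquiv R S (MulOpposite.opLinearEquiv R).symm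
  bijective := by
    let e : S ⊗[R] S ≃ₗ[R] Sᵐᵒᵖ ⊗[R] Sᵐᵒᵖ := TensorProduct.comm R S S ≪≫ₗ
      TensorProduct.congr (MulOpposite.opLinearEquiv R) (MulOpposite.opLinearEquiv R)
    -- `k f g = op (ρ g (f g⁻¹))`. Only its bijectivity matters, so linearity is not recorded.
    let k : (G → S) ≃ (G → Sᵐᵒᵖ) := ((Equiv.inv G).arrowCongr (Equiv.refl S)).trans
      (Equiv.piCongrRight fun g => (ρ g).toEquiv.trans MulOpposite.opEquiv)
    have h : galoisMap (opAction ρ) ∘ e = k ∘ galoisMap ρ :=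
      funext fun x => funext fun g => galoisMap_opAction ρ x g
    exact (Function.Bijective.of_comp_iff _ e.bijective).1
      (h ▸ k.bijective.comp hρ.bijective)

/-- For a one-element group, `Γ` is the multiplication `R ⊗ R ≃ R`, viewed as a function on a point.
-/
theorem IsGaloisExtension.self [Unique G] : IsGaloisExtension (1 : G →* (R ≃ₐ[R] R)) where
  faithfullyFlat := inferInstance
  bijective := by
    have h : galoisMap (1 : G →* (R ≃ₐ[R] R)) =
        ((TensorProduct.lid R R ≪≫ₗ
          (LinearEquiv.funUnique G R R).symm : R ⊗[R] R ≃ₗ[R] (G → R)) :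
            R ⊗[R] R →ₗ[R] (G → R)) := by
      ext g
      simp
    rw [h]
    exact (TensorProduct.lid R R ≪≫ₗ (LinearEquiv.funUnique G R R).symm).bijective

end Galois

/-! ### Closure of `BrGal R` under the group operations -/

namespace BrGal

variable {R : Type u} [CommRing R]

theorem one_mem : (1 : Br R) ∈ BrGal R :=
  ⟨Unit, inferInstance, inferInstance, R, inferInstance, inferInstance, 1,
    { IsGaloisExtension.self with isAzumaya := inferInstance }, rfl⟩

theorem mul_mem {x y : Br R} (hx : x ∈ BrGal R) (hy : y ∈ BrGal R) : x * y ∈ BrGal R := by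
  obtain ⟨G, _, _, S, _, _, ρ, hρ, rfl⟩ := hx
  obtain ⟨H, _, _, T, _, _, σ, hσ, rfl⟩ := hy
  have := hρ.isAzumaya
  have := hσ.isAzumaya
  exact ⟨G × H, inferInstance, inferInstance, S ⊗[R] T, inferInstance, inferInstance,
    tensorAction ρ σ,
    { hρ.toIsGaloisExtension.tensor hσ.toIsGaloisExtension with
      -- `rfl` suffices because the product of two classes is by definition the class of `S ⊗[R] T`.
      isAzumaya := isAzumaya_tensor R S T }, rfl⟩

theorem inv_mem {x : Br R} (hx : x ∈ BrGal R) : x⁻¹ ∈ BrGal R := by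
  obtain ⟨G, _, _, S, _, _, ρ, hρ, rfl⟩ := hx
  have := hρ.isAzumaya
  exact ⟨G, inferInstance, inferInstance, Sᵐᵒᵖ, inferInstance, inferInstance, opAction ρ,
    { hρ.toIsGaloisExtension.op with isAzumaya := isAzumaya_op R S }, rfl⟩

end BrGal

end BrauerGalois

/-- The set `Br_Gal(R)` is a subgroup of the Brauer group `Br(R)`. -/
theorem corollary3p3 (R : Type u) [CommRing R] :
    ∃ H : Subgroup (BrauerGalois.Br R), (H : Set (BrauerGalois.Br R)) = BrauerGalois.BrGal R :=
  ⟨{ carrier := BrauerGalois.BrGal R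
     one_mem' := BrauerGalois.BrGal.one_mem
     mul_mem' := BrauerGalois.BrGal.mul_mem
     inv_mem' := BrauerGalois.BrGal.inv_mem }, rfl⟩
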